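/- Conventions: $\mathbb N$ denotes the set of positive integers. For a subset $X$ of an abelian group $G$ and $n\in\mathbb N$, $nX=\{nx : x\in X\}$. For an infinite cardinal $\kappa$, $\log\kappa=\min\{\tau\ge\omega : \kappa\le 2^{\tau}\}$. A subset $S$ of a group $G$ is potentially dense in $G$ if $G$ admits a Hausdorff group topology in which $S$ is dense. A topological group is precompact if it is isomorphic, as a topological group, to a subgroup of some compact Hausdorff group. Let $G$ be an abelian group such that $|nG|=|G|$ for every $n\in\mathbb N$, and let $S$ be an uncountable subset of $G$. Then the following conditions are equivalent: (i) $S$ is potentially dense in $G$; (ii) $S$ is $\mathscr T$-dense in $G$ for some precompact group topology $\mathscr T$ on $G$; (iii) $\log\log|nG|\le|nS|$ for every $n\in\mathbb N$; (iv) $\log\log|G|\le\min\{|nS| : n\in\mathbb N\}$. -/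

import Mathlib

universe u

namespace PotentialDensity

/-- The logarithm of an infinite cardinal: `log κ = min {τ ≥ ω : κ ≤ 2 ^ τ}`. -/
noncomputable def cardLog (κ : Cardinal.{u}) : Cardinal.{u} :=
  sInf {τ : Cardinal.{u} | Cardinal.aleph0 ≤ τ ∧ κ ≤ 2 ^ τ}

/-- For a subset `X` of an abelian group, `nX = {n x : x ∈ X}` (the set of `n`-th multiples of
elements, not the `n`-fold sumset). -/
def multiples {G : Type u} [AddCommGroup G] (n : ℕ) (X : Set G) : Set G :=
  (fun x : G => n • x) '' X

/-- `S` is potentially dense in `G` if `G` admits a Hausdorff group topology in which `S` is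
dense. -/
def IsPotentiallyDense {G : Type u} [AddGroup G] (S : Set G) : Prop :=
  ∃ T : TopologicalSpace G,
    @IsTopologicalAddGroup G T _ ∧ @T2Space G T ∧ @Dense G T S

/-- A topological group is precompact if it is isomorphic (as a topological group) to a subgroup
of a compact Hausdorff group. In particular a precompact group is Hausdorff. -/
def IsPrecompactGroup (G : Type u) [AddGroup G] [TopologicalSpace G] : Prop :=
  ∃ (K : Type u) (_ : AddGroup K) (_ : TopologicalSpace K),
    IsTopologicalAddGroup K ∧ CompactSpace K ∧ T2Space K ∧
      ∃ f : G →+ K, Topology.IsEmbedding f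

/-- `S` is dense in `G` with respect to some precompact group topology on `G`. -/
def IsPrecompactlyDense {G : Type u} [AddGroup G] (S : Set G) : Prop :=
  ∃ T : TopologicalSpace G,
    @IsTopologicalAddGroup G T _ ∧ @IsPrecompactGroup G _ T ∧ @Dense G T S

end PotentialDensity

/-!
Density forces the cardinal bound: if `S` is dense in a Hausdorff group topology, then `n • S` is
dense in `n • G`, it is infinite, and a Hausdorff space with a dense subset of size `τ` has at most
`2 ^ 2 ^ τ` points (`mk_closure_le_of_t2`).

Conversely, let `K` have cardinality `log log |G|`, and suppose that every `n • S` has at least `#K`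
elements. A precompact topology comes from an injective homomorphism to a power of the circle
`UnitAddCircle`, and it is enough to find one, with at most `2 ^ #K` coordinates, that maps `S` onto
a dense set (`exists_injective_hom_dense`). Three ingredients are combined.

* `S` contains a family `s`, indexed by a set `D` with `#D ≤ #K`, at which the values of a character
  can be prescribed up to small errors (`exists_matching_family`). The point is that, for a suitable
  `n`, all `x ∈ S` outside a set with finite image under multiplication by `n` are almost independent
  of a given finite set of elements (`finite_multiples_not_almostFree`). If characters `χ y`, for
  `y ⊆ K`, are prescribed along `s` according to independent systems of targets
  (`exists_independent_targets`), they map `S` onto a dense set. This survives changing each system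
  of targets at finitely many indices.

* Let `H` be a maximal subgroup such that all targets can still be met by characters that kill `H`.
  By maximality, each `g ∉ H` has targets at finitely many indices that force `χ g ≠ 0` for all
  matching `χ` that kill `H` (`exists_detecting_targets`). Using all these finite modifications, one
  gets characters whose common kernel is contained in `H`.

* `G` has a family `φ` of characters, with at most `2 ^ #K` members, that separates points
  (`exists_separating_characters`). Add to each `φ q` a character `ψ q` that kills `H`, with targets
  chosen so that `ψ q + φ q` meets an independent system. As `ψ q` is trivial on `H`, the sums
  separate the points of `H`, and together with the previous characters those of `G`.
-/

namespace PotentialDensity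

variable {G : Type u} [AddCommGroup G]

/-! ### Characters of abelian groups with values in the circle -/

/-- Divisible abelian groups are injective. -/
theorem exists_hom_extension {M : Type*} [AddCommGroup M] [DivisibleBy M ℤ] (A : AddSubgroup G)
    (φ : A →+ M) : ∃ ψ : G →+ M, ∀ a : A, ψ a = φ a := by
  obtain ⟨ψ, hψ⟩ := (Module.Baer.of_divisible M).extension_property_addMonoidHom A.subtype
    A.subtype_injective φ
  exact ⟨ψ, fun a => by rw [← hψ]; rfl⟩

theorem exists_hom_apply_eq {M : Type*} [AddCommGroup M] [DivisibleBy M ℤ] (g : G) (t : M)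
    (h : ∀ k : ℤ, k • g = 0 → k • t = 0) : ∃ ψ : G →+ M, ψ g = t := by
  have hs := (zmultiplesHom G g).rangeRestrict_surjective
  have hker : (zmultiplesHom G g).rangeRestrict.ker ≤ (zmultiplesHom M t).ker := by
    intro k hk
    rw [AddMonoidHom.ker_rangeRestrict] at hk
    simp only [AddMonoidHom.mem_ker, zmultiplesHom_apply] at hk ⊢
    exact h k hk
  obtain ⟨ψ, hψ⟩ := exists_hom_extension _
    (AddMonoidHom.liftOfSurjective (zmultiplesHom G g).rangeRestrict hs ⟨zmultiplesHom M t, hker⟩)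
  have h1 : ((zmultiplesHom G g).rangeRestrict 1 : G) = g := one_zsmul g
  have h2 := AddMonoidHom.liftOfRightInverse_comp_apply (zmultiplesHom G g).rangeRestrict
    (Function.surjInv hs) (Function.rightInverse_surjInv hs) ⟨zmultiplesHom M t, hker⟩ 1
  have h3 := (hψ ((zmultiplesHom G g).rangeRestrict 1)).trans h2
  exact ⟨ψ, by rw [← h1, h3]; simp⟩

theorem exists_hom_vanishing_apply_eq {M : Type*} [AddCommGroup M] [DivisibleBy M ℤ]
    (A : AddSubgroup G) (g : G) (t : M) (h : ∀ k : ℤ, k • g ∈ A → k • t = 0) :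
    ∃ ψ : G →+ M, (∀ a ∈ A, ψ a = 0) ∧ ψ g = t := by
  obtain ⟨ψ, hψ⟩ := exists_hom_apply_eq (QuotientAddGroup.mk' A g) t (fun k hk => h k (by
    rw [← map_zsmul] at hk
    exact (QuotientAddGroup.eq_zero_iff _).1 hk))
  refine ⟨ψ.comp (QuotientAddGroup.mk' A), fun a ha => ?_, hψ⟩
  rw [AddMonoidHom.comp_apply, QuotientAddGroup.mk'_apply,
    (QuotientAddGroup.eq_zero_iff (N := A) a).2 ha, map_zero]

/-- Every cyclic group embeds in the circle. -/
theorem exists_circle_same_order (g : G) :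
    ∃ t : UnitAddCircle, ∀ k : ℤ, k • t = 0 ↔ k • g = 0 := by
  have key : ∃ t : UnitAddCircle, addOrderOf t = addOrderOf g := by
    rcases Nat.eq_zero_or_pos (addOrderOf g) with h0 | hpos
    · refine ⟨((√2 : ℝ) : UnitAddCircle), ?_⟩
      rw [h0, addOrderOf_eq_zero_iff', ]
      intro n hn h
      rw [← AddCircle.coe_nsmul, AddCircle.coe_eq_zero_iff] at h
      obtain ⟨m, hm⟩ := h
      have hirr := irrational_sqrt_two.natCast_mul hn.ne'
      apply hirr
      exact ⟨m, by simpa using hm⟩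
    · have : Fact ((0 : ℝ) < 1) := ⟨one_pos⟩
      exact ⟨((1 / (addOrderOf g : ℝ) : ℝ) : UnitAddCircle),
        AddCircle.addOrderOf_period_div hpos⟩
  obtain ⟨t, ht⟩ := key
  exact ⟨t, fun k => by
    rw [← addOrderOf_dvd_iff_zsmul_eq_zero, ← addOrderOf_dvd_iff_zsmul_eq_zero, ht]⟩

theorem norm_coe_circle_le (r : ℝ) : ‖(r : UnitAddCircle)‖ ≤ |r| := by
  rw [UnitAddCircle.norm_eq]
  simpa using round_le r 0

/-- If no `k • g` with `0 < k ≤ N` lies in `A`, the order of `g` modulo `A` is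
either infinite or some `m > N`; in the second case the characters killing `A` take all multiples
of `1 / m` as values at `g`. So they come within `1 / (N + 1)` of any point. -/
theorem exists_hom_vanishing_near (A : AddSubgroup G) (g : G) (N : ℕ)
    (h : ∀ k : ℕ, 0 < k → k ≤ N → k • g ∉ A) (τ : UnitAddCircle) :
    ∃ ψ : G →+ UnitAddCircle, (∀ a ∈ A, ψ a = 0) ∧ ‖ψ g - τ‖ ≤ 1 / (N + 1) := by
  have hmem : ∀ k : ℤ, k • g ∈ A ↔ (addOrderOf (QuotientAddGroup.mk' A g) : ℤ) ∣ k := by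
    intro k
    rw [addOrderOf_dvd_iff_zsmul_eq_zero, ← map_zsmul]
    exact (QuotientAddGroup.eq_zero_iff _).symm
  generalize addOrderOf (QuotientAddGroup.mk' A g) = m at hmem
  rcases Nat.eq_zero_or_pos m with rfl | hm
  · obtain ⟨ψ, h1, h2⟩ := exists_hom_vanishing_apply_eq A g τ (fun k hk => by
      have := (hmem k).1 hk
      simp only [Nat.cast_zero, zero_dvd_iff] at this
      simp [this])
    exact ⟨ψ, h1, by rw [h2, sub_self, norm_zero]; positivity⟩
  · have hNm : N + 1 ≤ m := by
      by_contra hlt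
      exact h m hm (by omega) (by exact_mod_cast (hmem m).2 dvd_rfl)
    induction τ using QuotientAddGroup.induction_on with
    | H r =>
    have hm' : (0 : ℝ) < m := by exact_mod_cast hm
    obtain ⟨ψ, h1, h2⟩ := exists_hom_vanishing_apply_eq A g
      ((((round (r * m) : ℤ) : ℝ) / m : ℝ) : UnitAddCircle) (fun k hk => by
        obtain ⟨j, rfl⟩ := (hmem k).1 hk
        rw [← AddCircle.coe_zsmul, AddCircle.coe_eq_zero_iff]
        refine ⟨j * round (r * m), ?_⟩
        simp only [zsmul_eq_mul]
        push_cast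
        field_simp)
    refine ⟨ψ, h1, ?_⟩
    rw [h2]
    have : ((((round (r * m) : ℤ) : ℝ) / m : ℝ) : UnitAddCircle) - (r : UnitAddCircle)
        = (((round (r * m) : ℤ) : ℝ) / m - r : ℝ) := (AddCircle.coe_sub _ _ _).symm
    refine (le_of_eq (congrArg norm this)).trans ((norm_coe_circle_le _).trans ?_)
    have e : ((round (r * m) : ℤ) : ℝ) / m - r = -((r * m - round (r * m)) / m) := by
      field_simp; ring
    rw [e, abs_neg, abs_div, abs_of_pos hm']
    have h3 := abs_sub_round (r * m)
    have h4 : (N : ℝ) + 1 ≤ m := by exact_mod_cast hNm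
    exact div_le_div₀ one_pos.le (h3.trans (by norm_num)) (by positivity) h4

/-- Compactness of the group of characters: closed conditions on the values of a character can be
met simultaneously as soon as any finitely many of them can. -/
theorem exists_character_of_finite {J : Type*} (g : J → G) (C : J → Set UnitAddCircle)
    (hC : ∀ j, IsClosed (C j))
    (h : ∀ E : Finset J, ∃ χ : G →+ UnitAddCircle, ∀ j ∈ E, χ (g j) ∈ C j) :
    ∃ χ : G →+ UnitAddCircle, ∀ j, χ (g j) ∈ C j := by
  let Z : Set (G → UnitAddCircle) := {f | ∀ x y, f (x + y) = f x + f y}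
  have hZ : IsClosed Z := by
    simp only [Z, Set.ofPred_forall]
    refine isClosed_iInter fun x => isClosed_iInter fun y => ?_
    exact isClosed_eq (continuous_apply _) ((continuous_apply x).fun_add (continuous_apply y))
  have := hZ.isCompact.inter_iInter_nonempty (fun j => {f | f (g j) ∈ C j})
    (fun j => (hC j).preimage (continuous_apply (g j))) (fun E => by
      obtain ⟨χ, hχ⟩ := h E
      refine ⟨χ, fun x y => map_add χ x y, ?_⟩
      simpa using hχ)
  obtain ⟨f, hf, hf'⟩ := this
  refine ⟨AddMonoidHom.mk' f hf, fun j => ?_⟩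
  simp only [Set.mem_iInter] at hf'
  exact hf' j

/-! ### Elements that are almost independent of a finite set -/

/-- In a finitely generated abelian group, a set on which all the real characters that are small
on the given finite family are uniformly bounded is finite: the coordinates of the free part are
multiples of such characters, and the torsion part is finite. -/
theorem finite_setOf_abs_hom_le {A ι : Type*} [AddCommGroup A] [AddGroup.FG A] [Fintype ι]
    (x : ι → A) (η C : ℝ) (hη : 0 < η) :
    {a : A | ∀ θ : A →+ ℝ, (∀ i, |θ (x i)| ≤ η) → |θ a| ≤ C}.Finite := by
  classical
  obtain ⟨n, κ, _, p, hp, e, ⟨f⟩⟩ := AddCommGroup.equiv_free_prod_directSum_zmod A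
  have : ∀ i, NeZero (p i ^ e i) := fun i => ⟨pow_ne_zero _ (hp i).ne_zero⟩
  have hfin : Finite (DirectSum κ fun i => ZMod (p i ^ e i)) :=
    Finite.of_equiv _ (DirectSum.addEquivProd fun i => ZMod (p i ^ e i)).symm.toEquiv
  -- `θ j` is the `j`-th coordinate of the free part, and `(η / M j) • θ j` is a test character.
  let θ : Fin n → A →+ ℝ := fun j => (Int.castAddHom ℝ).comp
    ((Finsupp.applyAddHom j).comp ((AddMonoidHom.fst _ _).comp f.toAddMonoidHom))
  have hθ : ∀ j a, θ j a = ((f a).1 j : ℤ) := fun j a => rfl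
  let M : Fin n → ℝ := fun j => 1 + ∑ i, |θ j (x i)|
  have hM : ∀ j, 0 < M j := fun j => by positivity
  let B : Set (Fin n →₀ ℤ) := (fun h => (h : Fin n → ℤ)) ⁻¹'
    (Set.univ.pi fun j => Set.Icc (-⌈C * M j / η⌉) ⌈C * M j / η⌉)
  have hB : B.Finite := (Set.Finite.pi' fun j => Set.finite_Icc _ _).preimage
    (DFunLike.coe_injective.injOn) |>.subset (fun h hh j => hh j trivial)
  refine ((hB.prod Set.finite_univ).preimage f.injective.injOn).subset fun a ha => ?_
  refine ⟨fun j _ => ?_, trivial⟩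
  have h1 := ha ((AddMonoidHom.mulLeft (η / M j)).comp (θ j)) (fun i => by
    have h2 : |θ j (x i)| ≤ M j := by
      have := Finset.single_le_sum (f := fun i => |θ j (x i)|) (fun i _ => abs_nonneg _)
        (Finset.mem_univ i)
      simp only [M]; linarith
    rw [AddMonoidHom.comp_apply, AddMonoidHom.coe_mulLeft, abs_mul,
      abs_of_pos (div_pos hη (hM j)), div_mul_eq_mul_div, div_le_iff₀ (hM j)]
    exact mul_le_mul_of_nonneg_left h2 hη.le)
  rw [AddMonoidHom.comp_apply, AddMonoidHom.coe_mulLeft, abs_mul,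
      abs_of_pos (div_pos hη (hM j)), div_mul_eq_mul_div, div_le_iff₀ (hM j), mul_comm,
      ← le_div_iff₀ hη, hθ] at h1
  have h3 := abs_le.1 (h1.trans (Int.le_ceil _))
  exact ⟨by exact_mod_cast h3.1, by exact_mod_cast h3.2⟩

/-- `s` is almost free over the finite set `F` if every character can be modified so that its value
at `s` comes within `1 / (N + 1)` of any prescribed point, while its values on `F` move by at most
`η`. -/
def AlmostFree (F : Finset G) (N : ℕ) (η : ℝ) (s : G) : Prop :=
  ∀ (χ₀ : G →+ UnitAddCircle) (τ : UnitAddCircle), ∃ χ : G →+ UnitAddCircle,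
    (∀ x ∈ F, ‖χ x - χ₀ x‖ ≤ η) ∧ ‖χ s - τ‖ ≤ 1 / (N + 1)

/-- The characters `χ₀ + c • θ` with `|c| ≤ 1` take every value at `s`, because `c * θ s` runs over
an interval of length more than `1`. -/
theorem AlmostFree.of_real_hom {F : Finset G} {η : ℝ} {s : G} (N : ℕ) (θ : G →+ ℝ)
    (hF : ∀ x ∈ F, |θ x| ≤ η) (hs : 1 < |θ s|) : AlmostFree F N η s := by
  intro χ₀ τ
  have hs0 : θ s ≠ 0 := fun h => by simp [h] at hs; linarith
  obtain ⟨r, hr⟩ : ∃ r : ℝ, (r : UnitAddCircle) = τ - χ₀ s := QuotientAddGroup.mk_surjective _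
  have hfr : ((Int.fract r : ℝ) : UnitAddCircle) = τ - χ₀ s := by
    rw [← hr, ← sub_eq_zero, ← AddCircle.coe_sub, AddCircle.coe_eq_zero_iff]
    exact ⟨-⌊r⌋, by rw [← Int.self_sub_floor]; simp⟩
  let c : ℝ := Int.fract r / θ s
  have hc : |c| ≤ 1 := by
    rw [abs_div, abs_of_nonneg (Int.fract_nonneg r), div_le_one (by linarith)]
    linarith [Int.fract_lt_one r]
  let π : ℝ →+ UnitAddCircle := QuotientAddGroup.mk' _
  refine ⟨χ₀ + π.comp ((AddMonoidHom.mulLeft c).comp θ), fun x hx => ?_, ?_⟩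
  · rw [AddMonoidHom.add_apply, add_sub_cancel_left]
    refine (norm_coe_circle_le (c * θ x)).trans ?_
    rw [abs_mul]
    exact (mul_le_of_le_one_left (abs_nonneg _) hc).trans (hF x hx)
  · have : π (c * θ s) = τ - χ₀ s := by
      simp only [c, div_mul_cancel₀ _ hs0]
      exact hfr
    rw [AddMonoidHom.add_apply, AddMonoidHom.comp_apply, AddMonoidHom.comp_apply,
      AddMonoidHom.coe_mulLeft, this, add_sub_cancel, sub_self, norm_zero]
    positivity

/-- Only finitely many values `N! • s` arise from elements `s` that are not almost free over `F`.
Let `A` be the subgroup generated by `F`. If `N! • s ∉ A`, then `s` has large order modulo `A`.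
If `N! • s ∈ A`, then for all but finitely many values of `N! • s` some real character is small on
`F` and larger than `1` at `s`, and its multiples sweep out the circle at `s`. The factor `N!` does
not depend on `F` or `η`. -/
theorem finite_multiples_not_almostFree (F : Finset G) (N : ℕ) (η : ℝ) (hη : 0 < η) :
    ((fun s : G => N.factorial • s) '' {s | ¬ AlmostFree F N η s}).Finite := by
  let A : AddSubgroup G := AddSubgroup.closure (F : Set G)
  have hFG : AddGroup.FG A := AddGroup.closure_finset_fg F
  have hFA : ∀ x ∈ F, x ∈ A := fun x hx => AddSubgroup.subset_closure hx
  have hfin := finite_setOf_abs_hom_le (A := A) (fun x : F => ⟨x, hFA x x.2⟩) η N.factorial hη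
  refine (hfin.image A.subtype).subset ?_
  rintro _ ⟨s, hs, rfl⟩
  have hmem : N.factorial • s ∈ A := by
    by_contra hnot
    refine hs fun χ₀ τ => ?_
    obtain ⟨ψ, h1, h2⟩ := exists_hom_vanishing_near A s N (fun k hk hkN hks => hnot (by
      obtain ⟨m, hm⟩ := Nat.dvd_factorial hk hkN
      rw [hm, mul_comm, mul_smul]
      exact A.nsmul_mem hks m)) (τ - χ₀ s)
    refine ⟨χ₀ + ψ, fun x hx => ?_, ?_⟩
    · simp [h1 x (hFA x hx), hη.le]
    · rwa [AddMonoidHom.add_apply, add_comm, add_sub_assoc, ← neg_sub τ, ← sub_eq_add_neg]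
  refine ⟨⟨_, hmem⟩, fun θ hθ => ?_, rfl⟩
  by_contra hlt
  obtain ⟨ψ, hψ⟩ := exists_hom_extension A θ
  refine hs (AlmostFree.of_real_hom N ψ (fun x hx => ?_) ?_)
  · have := hψ ⟨x, hFA x hx⟩
    simp only at this
    rw [this]
    exact hθ ⟨x, hx⟩
  · rw [← hψ] at hlt
    simp only [not_le, map_nsmul, nsmul_eq_mul, abs_mul, Nat.abs_cast] at hlt
    have : (0 : ℝ) < N.factorial := by exact_mod_cast N.factorial_pos
    exact (lt_mul_iff_one_lt_right this).1 hlt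

/-! ### Families whose character values can be prescribed -/

open Cardinal in
theorem mk_iUnion_finite_lt {ι α : Type u} (f : ι → Set α) (hf : ∀ i, (f i).Finite)
    {c : Cardinal.{u}} (hc : ℵ₀ ≤ c) (hι : #ι < c) : #(⋃ i, f i) < c := by
  rcases finite_or_infinite ι with h | h
  · exact ((Set.finite_iUnion hf).lt_aleph0).trans_le hc
  · refine (mk_iUnion_le f).trans_lt (lt_of_le_of_lt ?_ hι)
    refine (mul_le_max_of_aleph0_le_left (aleph0_le_mk ι)).trans (max_le le_rfl ?_)
    exact (ciSup_le' fun i => (hf i).lt_aleph0.le).trans (aleph0_le_mk ι)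

/-- How far the values at the members of the family indexed by `E` may move when one more member
is treated. The powers of `1 / 2` make the total movement of each value summable, and the
denominator keeps it below the precision `1 / (N d + 1)` wanted at each `d ∈ E`. -/
noncomputable def tolerance {D : Type u} (N : D → ℕ) (E : Finset D) : ℝ :=
  (1 / 2) ^ E.card / (1 + ∑ d ∈ E, (N d : ℝ))

theorem tolerance_pos {D : Type u} (N : D → ℕ) (E : Finset D) : 0 < tolerance N E := by
  unfold tolerance; positivity

theorem tolerance_le {D : Type u} (N : D → ℕ) (E : Finset D) {d : D} (hd : d ∈ E) :
    tolerance N E ≤ (1 / 2) ^ E.card / (N d + 1) := by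
  unfold tolerance
  have := Finset.single_le_sum (f := fun d => (N d : ℝ)) (fun i _ => Nat.cast_nonneg _) hd
  rw [add_comm (N d : ℝ)]
  gcongr

open Cardinal in
/-- Fewer than `#D` finite sets lie below `d`, and each of them excludes only finitely many values
of `(N d)! • x`; since `(N d)! • S` has at least `#D` elements, some `x ∈ S` is almost free over all
of them. This covers countable and uncountable `D` alike. -/
theorem exists_almostFree_of_card {D : Type u} [LinearOrder D] [Infinite D] (N : D → ℕ)
    (S : Set G) (hS : ∀ n : ℕ, 0 < n → #D ≤ #(multiples n S)) (d : D) (hd : #(Set.Iio d) < #D)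
    (p : D → G) :
    ∃ x ∈ S, ∀ E : Finset D, (∀ e ∈ E, e < d) →
      ∀ F : Finset G, (F : Set G) = p '' E → AlmostFree F (N d) (tolerance N E) x := by
  classical
  have hfin := fun E : Finset (Set.Iio d) => finite_multiples_not_almostFree
    ((E.map (Function.Embedding.subtype _)).image p) (N d) _
    (tolerance_pos N (E.map (Function.Embedding.subtype _)))
  have hcard : #(Finset (Set.Iio d)) < #D := by
    rcases finite_or_infinite (Set.Iio d) with h | h
    · exact (lt_aleph0_of_finite _).trans_le (aleph0_le_mk D)
    · rwa [mk_finset_of_infinite]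
  have hlt := (mk_iUnion_finite_lt _ hfin (aleph0_le_mk D) hcard).trans_le
    (hS _ (N d).factorial_pos)
  obtain ⟨_, ⟨x, hx, rfl⟩, hx'⟩ : ∃ y ∈ multiples (N d).factorial S, y ∉ _ := by
    by_contra! hall
    exact hlt.not_ge (mk_le_mk_of_subset hall)
  refine ⟨x, hx, fun E hE F hF => ?_⟩
  by_contra hnot
  refine hx' (Set.mem_iUnion.2 ⟨E.subtype (· ∈ Set.Iio d), x, ?_, rfl⟩)
  have hE' : (E.subtype (· ∈ Set.Iio d)).map (Function.Embedding.subtype _) = E :=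
    Finset.subtype_map_of_mem hE
  have hF' : E.image p = F := by
    rw [← Finset.coe_inj, hF, Finset.coe_image]
  simp only [Set.mem_ofPred_eq, hE', hF']
  exact hnot

open Cardinal in
/-- If all the sets `n • S` have at least `#D` elements, then `S` contains a family indexed by `D`
at which the values of a character can be prescribed, up to an error of
`2 / (N d + 1)`. The family is built by recursion along a well-order of `D` of minimal type. -/
theorem exists_matching_family {D : Type u} [Infinite D] (N : D → ℕ)
    (S : Set G) (hS : ∀ n : ℕ, 0 < n → #D ≤ #(multiples n S)) :
    ∃ s : D → G, (∀ d, s d ∈ S) ∧ ∀ (E : Finset D) (τ : D → UnitAddCircle),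
      ∃ χ : G →+ UnitAddCircle, ∀ d ∈ E, ‖χ (s d) - τ d‖ ≤ 2 / (N d + 1) := by
  classical
  obtain ⟨_, _, hord⟩ := exists_ord_eq_type_lt D
  choose c hcS hc using fun d => exists_almostFree_of_card N S hS d (mk_Iio_lt d hord)
  let s : D → G := (wellFounded_lt (α := D)).fix
    fun d rec => c d fun e => if h : e < d then rec e h else 0
  have hs : ∀ d, s d = c d fun e => if e < d then s e else 0 := fun d => by
    simp only [s]
    rw [WellFounded.fix_eq]
    simp
  refine ⟨s, fun d => by rw [hs]; exact hcS _ _, fun E τ => ?_⟩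
  -- The factor `2 - 2 * (1 / 2) ^ E.card` leaves room for the movements at later steps.
  have key : ∃ χ : G →+ UnitAddCircle, ∀ d ∈ E,
      ‖χ (s d) - τ d‖ ≤ (2 - 2 * (1 / 2) ^ E.card) / (N d + 1) := by
    induction E using Finset.induction_on_max with
    | empty => exact ⟨0, by simp⟩
    | insert a E hlt ih =>
      obtain ⟨χ₀, hχ₀⟩ := ih
      have ha : a ∉ E := fun h => (hlt a h).false
      obtain ⟨χ, h1, h2⟩ := hc a (fun e => if e < a then s e else 0) E hlt (E.image s) (by
        rw [Finset.coe_image]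
        exact Set.image_congr fun e he => by simp [hlt e he]) χ₀ (τ a)
      rw [← hs] at h2
      refine ⟨χ, fun d hd => ?_⟩
      rw [Finset.card_insert_of_notMem ha]
      rcases Finset.mem_insert.1 hd with rfl | hd
      · refine h2.trans ?_
        gcongr
        have : (1 / 2 : ℝ) ^ E.card ≤ 1 := pow_le_one₀ (by norm_num) (by norm_num)
        rw [pow_succ]; linarith
      · have h3 := (h1 (s d) (Finset.mem_image_of_mem s hd)).trans (tolerance_le N E hd)
        calc ‖χ (s d) - τ d‖ ≤ ‖χ (s d) - χ₀ (s d)‖ + ‖χ₀ (s d) - τ d‖ :=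
              norm_sub_le_norm_sub_add_norm_sub _ _ _
          _ ≤ (1 / 2) ^ E.card / (N d + 1) + (2 - 2 * (1 / 2) ^ E.card) / (N d + 1) :=
            add_le_add h3 (hχ₀ d hd)
          _ = _ := by rw [← add_div, pow_succ]; ring
  obtain ⟨χ, hχ⟩ := key
  refine ⟨χ, fun d hd => (hχ d hd).trans ?_⟩
  gcongr
  have : (0 : ℝ) ≤ (1 / 2) ^ E.card := by positivity
  linarith

/-! ### Separating the points of a group by few characters -/

open Classical in
/-- Finitely many subsets of `L` are distinguished by their traces on one finite set. -/
theorem exists_finset_separating {L : Type u} (I : Finset (Set L)) :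
    ∃ F : Finset L, ∀ y ∈ I, ∀ z ∈ I, F.filter (· ∈ y) = F.filter (· ∈ z) → y = z := by
  have : ∀ q : Set L × Set L, ∃ F : Finset L,
      F.filter (· ∈ q.1) = F.filter (· ∈ q.2) → q.1 = q.2 := by
    rintro ⟨y, z⟩
    by_cases h : y = z
    · exact ⟨∅, fun _ => h⟩
    · obtain ⟨l, hl⟩ : ∃ l, ¬ (l ∈ y ↔ l ∈ z) := by
        by_contra! hall
        exact h (Set.ext hall)
      refine ⟨{l}, fun he => absurd ?_ hl⟩
      have := Finset.ext_iff.1 he l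
      simpa using this
  choose F hF using this
  refine ⟨(I ×ˢ I).biUnion F, fun y hy z hz he => hF (y, z) ?_⟩
  ext l
  have hl := Finset.ext_iff.1 he l
  have hsub : l ∈ F (y, z) → l ∈ (I ×ˢ I).biUnion F := fun h =>
    Finset.mem_biUnion.2 ⟨_, Finset.mem_product.2 ⟨hy, hz⟩, h⟩
  simp only [Finset.mem_filter] at hl ⊢
  tauto

open Classical in
/-- The values of characters on `X` can be chosen as `t x` or `0`, independently at each point.
If `t x` has the same order as `x`, this is a form of independence of `X`. -/
def IsFlexible (t : G → UnitAddCircle) (X : Set G) : Prop :=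
  ∀ U : Set G, ∃ χ : G →+ UnitAddCircle, ∀ x ∈ X, χ x = if x ∈ U then t x else 0

theorem exists_maximal_isFlexible (t : G → UnitAddCircle) :
    ∃ X, Maximal (IsFlexible t) X := by
  classical
  refine zorn_subset {X | IsFlexible t X} fun c hc hchain => ⟨⋃₀ c, fun U => ?_,
    fun X hX => Set.subset_sUnion_of_mem hX⟩
  obtain ⟨χ, hχ⟩ := exists_character_of_finite (fun x : ⋃₀ c => (x : G))
    (fun x => {if (x : G) ∈ U then t x else 0}) (fun x => isClosed_singleton) (fun E => by
      rcases c.eq_empty_or_nonempty with rfl | hne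
      · exact ⟨0, fun x => absurd x.2 (by simp)⟩
      · obtain ⟨X, hX, hEX⟩ := hchain.directedOn.exists_mem_subset_of_finset_subset_biUnion
          (f := id) hne (s := E.map (Function.Embedding.subtype _)) (by
            intro x hx
            obtain ⟨y, -, rfl⟩ := Finset.mem_map.1 hx
            simpa using Set.mem_sUnion.1 y.2)
        obtain ⟨χ, hχ⟩ := hc hX U
        exact ⟨χ, fun x hx => hχ x (hEX (Finset.mem_map_of_mem _ hx))⟩)
  exact ⟨χ, fun x hx => hχ ⟨x, hx⟩⟩

open Classical in
/-- A group that injects into the power set of `L` has characters, indexed by pairs of finite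
subsets of `L`, that separate its points. Take a maximal flexible set `X`, labelled by subsets of
`L`, and for every pair `(F, u)` a character equal to `t` at the `x ∈ X` whose label has trace `u`
on `F`, and to `0` at the other elements of `X`. Traces isolate one term of any combination of
elements of `X`, so these characters separate the subgroup generated by `X`. An element killed by
all of them then generates a group independent of `X`, and is `0` by maximality. -/
theorem exists_separating_characters {L : Type u} (ι : G ↪ Set L) :
    ∃ f : Finset L × Finset L → G →+ UnitAddCircle, ∀ g, (∀ p, f p g = 0) → g = 0 := by
  choose t ht using exists_circle_same_order (G := G)
  obtain ⟨X, hX, hmax⟩ := exists_maximal_isFlexible t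
  choose χ hχ using hX
  let f : Finset L × Finset L → G →+ UnitAddCircle := fun p =>
    χ {x | p.1.filter (· ∈ ι x) = p.2}
  let A : AddSubgroup G := (Submodule.span ℤ X).toAddSubgroup
  have hXA : ∀ x ∈ X, x ∈ A := fun x hx => Submodule.subset_span hx
  have hA : ∀ h ∈ A, (∀ p, f p h = 0) → h = 0 := by
    intro h hh hf
    obtain ⟨c, hcX, rfl⟩ := (Submodule.mem_span_set (R := ℤ)).1 hh
    obtain ⟨F, hF⟩ := exists_finset_separating (c.support.map ι)
    refine Finset.sum_eq_zero fun x hx => ?_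
    have h1 := hf (F, F.filter (· ∈ ι x))
    rw [Finsupp.sum, map_sum, Finset.sum_eq_single x] at h1
    · simp only [map_zsmul, f] at h1
      rw [hχ _ x (hcX hx), if_pos (by exact rfl)] at h1
      exact (ht x _).1 h1
    · intro z hz hzx
      simp only [map_zsmul, f]
      rw [hχ _ z (hcX hz), if_neg, smul_zero]
      intro he
      exact hzx (ι.injective (hF _ (Finset.mem_map_of_mem ι hz) _
        (Finset.mem_map_of_mem ι hx) he))
    · exact fun h => absurd hx h
  refine ⟨f, fun g hg => ?_⟩
  have hgA : ∀ k : ℤ, k • g ∈ A → k • g = 0 := fun k hk => hA _ hk fun p => by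
    rw [map_zsmul, hg, smul_zero]
  have hins : IsFlexible t (insert g X) := by
    intro U
    obtain ⟨ψ, hψA, hψg⟩ := exists_hom_vanishing_apply_eq A g
      ((if g ∈ U then t g else 0) - χ U g) (fun k hk => by
        have hk0 := hgA k hk
        rw [smul_sub, ← map_zsmul, hk0, map_zero, sub_zero]
        split_ifs
        · exact (ht g k).2 hk0
        · exact smul_zero k)
    refine ⟨χ U + ψ, ?_⟩
    rintro x (rfl | hx)
    · rw [AddMonoidHom.add_apply, hψg, add_sub_cancel]
    · rw [AddMonoidHom.add_apply, hψA x (hXA x hx), add_zero, hχ U x hx]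
  have hgX : g ∈ X := hmax hins (Set.subset_insert g X) (Set.mem_insert g X)
  simpa using hgA 1 (by simpa using hXA g hgX)

/-! ### Subgroups killed by matching characters, and independent targets -/

/-- Every finite system of targets `τ` for the values at the `s d` is met, to precision `ε d`, by a
character that kills the subgroup `H`. -/
def Matches {D : Type u} (s : D → G) (ε : D → ℝ) (H : AddSubgroup G) : Prop :=
  ∀ (E : Finset D) (τ : D → UnitAddCircle), ∃ χ : G →+ UnitAddCircle,
    (∀ g ∈ H, χ g = 0) ∧ ∀ d ∈ E, ‖χ (s d) - τ d‖ ≤ ε d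

theorem exists_character_vanishing_of_finite {D : Type u} (s : D → G) (ε : D → ℝ) (X : Set G)
    (τ : D → UnitAddCircle)
    (h : ∀ (A : Finset G) (E : Finset D), (A : Set G) ⊆ X → ∃ χ : G →+ UnitAddCircle,
      (∀ g ∈ A, χ g = 0) ∧ ∀ d ∈ E, ‖χ (s d) - τ d‖ ≤ ε d) :
    ∃ χ : G →+ UnitAddCircle, (∀ g ∈ X, χ g = 0) ∧ ∀ d, ‖χ (s d) - τ d‖ ≤ ε d := by
  classical
  obtain ⟨χ, hχ⟩ := exists_character_of_finite (J := X ⊕ D) (Sum.elim (fun x => (x : G)) s)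
    (Sum.elim (fun _ => {0}) fun d => {x | ‖x - τ d‖ ≤ ε d})
    (by
      rintro (x | d)
      · exact isClosed_singleton
      · exact isClosed_le (continuous_id.sub continuous_const).norm continuous_const)
    (fun E => by
      obtain ⟨χ, h1, h2⟩ := h (E.toLeft.image Subtype.val) E.toRight (by
        intro x hx
        obtain ⟨y, -, rfl⟩ := Finset.mem_image.1 hx
        exact y.2)
      refine ⟨χ, ?_⟩
      rintro (x | d) hj
      · exact h1 x (Finset.mem_image_of_mem _ (Finset.mem_toLeft.2 hj))
      · exact h2 d (Finset.mem_toRight.2 hj))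
  exact ⟨χ, fun g hg => hχ (Sum.inl ⟨g, hg⟩), fun d => hχ (Sum.inr d)⟩

/-- By compactness the targets can be met at all `d` simultaneously. -/
theorem Matches.exists_character {D : Type u} {s : D → G} {ε : D → ℝ} {H : AddSubgroup G}
    (hH : Matches s ε H) (τ : D → UnitAddCircle) :
    ∃ χ : G →+ UnitAddCircle, (∀ g ∈ H, χ g = 0) ∧ ∀ d, ‖χ (s d) - τ d‖ ≤ ε d :=
  exists_character_vanishing_of_finite s ε H τ fun _ E hA =>
    let ⟨χ, h1, h2⟩ := hH E τ
    ⟨χ, fun g hg => h1 g (hA hg), h2⟩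

/-- `Matches s ε` passes to unions of chains of subgroups, by compactness. -/
theorem exists_maximal_matches {D : Type u} {s : D → G} {ε : D → ℝ} (h : Matches s ε ⊥) :
    ∃ H, Maximal (Matches s ε) H := by
  suffices hch : ∀ c ⊆ {H | Matches s ε H}, IsChain (· ≤ ·) c → ∀ y ∈ c, Matches s ε (sSup c) by
    obtain ⟨H, -, hH⟩ := zorn_le_nonempty₀ {H | Matches s ε H} (fun c hc hchain y hy =>
      ⟨sSup c, hch c hc hchain y hy, fun K hK => le_sSup hK⟩) ⊥ h
    exact ⟨H, hH⟩
  intro c hc hchain y hy E τ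
  have hne : c.Nonempty := ⟨y, hy⟩
  obtain ⟨χ, h1, h2⟩ := exists_character_vanishing_of_finite s ε (sSup c : AddSubgroup G) τ
    (fun A E hA => by
      obtain ⟨K, hK, hAK⟩ := DirectedOn.exists_mem_subset_of_finset_subset_biUnion
        (f := fun K : AddSubgroup G => (K : Set G)) hne hchain.directedOn (s := A) (by
          intro x hx
          have := (AddSubgroup.mem_sSup_of_directedOn hne hchain.directedOn).1 (hA hx)
          simpa using this)
      obtain ⟨χ, h1, h2⟩ := hc hK E τ
      exact ⟨χ, fun g hg => h1 g (hAK hg), h2⟩)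
  exact ⟨χ, h1, fun d _ => h2 d⟩

/-- Over a maximal subgroup `H`, each `g ∉ H` comes with targets on a *finite* set which force a
character killing `H` not to kill `g`. Finiteness allows these targets to be imposed on a character
without disturbing its values at the rest of the family. -/
theorem exists_detecting_targets {D : Type u} {s : D → G} {ε : D → ℝ} {H : AddSubgroup G}
    (hH : Maximal (Matches s ε) H) {g : G} (hg : g ∉ H) :
    ∃ (E : Finset D) (τ : D → UnitAddCircle), ∀ χ : G →+ UnitAddCircle,
      (∀ x ∈ H, χ x = 0) → (∀ d ∈ E, ‖χ (s d) - τ d‖ ≤ ε d) → χ g ≠ 0 := by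
  have hnot : ¬ Matches s ε (H ⊔ AddSubgroup.zmultiples g) := fun h =>
    hg (hH.2 h le_sup_left (le_sup_right (a := H) (AddSubgroup.mem_zmultiples g)))
  simp only [Matches, not_forall, not_exists, not_and] at hnot
  obtain ⟨E, τ, hEτ⟩ := hnot
  refine ⟨E, τ, fun χ h1 h2 h3 => ?_⟩
  have hle : H ⊔ AddSubgroup.zmultiples g ≤ χ.ker :=
    sup_le h1 (by rw [AddSubgroup.zmultiples_le]; exact h3)
  obtain ⟨d, hd, hd'⟩ := hEτ χ fun x hx => hle hx
  exact hd' (h2 d hd)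

open Cardinal Classical in
/-- A Hewitt-Marczewski-Pondiczery construction: `2 ^ #K` systems of targets on an index set of
size at most `#K`, such that any values for finitely many systems are approximated at infinitely
many indices, with `N` as large as desired. An index records a finite set `F`, integers attached to
the subsets of `F`, and a common denominator; the system `y` reads off the integer attached to its
trace on `F`. -/
theorem exists_independent_targets (K : Type u) [Infinite K] :
    ∃ (D : Type u) (_ : Infinite D) (N : D → ℕ) (t : Set K → D → UnitAddCircle), #D ≤ #K ∧
      ∀ (I : Finset (Set K)) (z : Set K → UnitAddCircle) (δ : ℝ), 0 < δ →
        {d | 2 / (N d + 1) < δ ∧ ∀ y ∈ I, ‖t y d - z y‖ < δ}.Infinite := by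
  refine ⟨Finset K × (Finset K →₀ ℤ) × ℕ, inferInstance, fun d => d.2.2, fun y d =>
    (((d.2.1 (d.1.filter (· ∈ y)) : ℤ) : ℝ) / (d.2.2 + 1) : ℝ), ?_, fun I z δ hδ => ?_⟩
  · have := aleph0_le_mk K
    simp [this]
  · obtain ⟨F, hF⟩ := exists_finset_separating I
    have hr : ∀ y, ∃ r : ℝ, (r : UnitAddCircle) = z y :=
      fun y => QuotientAddGroup.mk_surjective _
    choose r hr using hr
    obtain ⟨n₀, hn₀⟩ := exists_nat_gt (2 / δ)
    -- Attach to the trace of each `y ∈ I` the numerator approximating `z y`; all large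
    -- denominators give suitable indices.
    let a : ℕ → Finset K × (Finset K →₀ ℤ) × ℕ := fun n =>
      (F, ∑ y ∈ I, Finsupp.single (F.filter (· ∈ y)) (round (r y * ((n + n₀ : ℕ) + 1))), n + n₀)
    refine Set.infinite_of_injective_forall_mem (f := a) (fun m n h => ?_) fun n => ?_
    · have := congrArg (fun q => q.2.2) h
      simpa [a] using this
    · have hpos : (0 : ℝ) < ((n + n₀ : ℕ) : ℝ) + 1 := by positivity
      have hlt : 2 / (((n + n₀ : ℕ) : ℝ) + 1) < δ := by
        rw [div_lt_iff₀ hδ] at hn₀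
        rw [div_lt_iff₀ hpos]
        push_cast
        nlinarith
      refine ⟨hlt, fun y hy => ?_⟩
      have hval : (a n).2.1 (F.filter (· ∈ y)) = round (r y * ((n + n₀ : ℕ) + 1)) := by
        simp only [a]
        rw [Finsupp.finsetSum_apply, Finset.sum_eq_single y]
        · rw [Finsupp.single_eq_same]
        · intro w hw hwy
          exact Finsupp.single_eq_of_ne fun he => hwy (hF y hy w hw he).symm
        · exact fun h => absurd hy h
      have e : ((((a n).2.1 (F.filter (· ∈ y)) : ℤ) : ℝ) / ((n + n₀ : ℕ) + 1) : ℝ) - r y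
          = -((r y * ((n + n₀ : ℕ) + 1) - round (r y * ((n + n₀ : ℕ) + 1))) /
            ((n + n₀ : ℕ) + 1)) := by
        rw [hval]; field_simp; ring
      have := norm_coe_circle_le
        (((((a n).2.1 (F.filter (· ∈ y)) : ℤ) : ℝ) / ((n + n₀ : ℕ) + 1) : ℝ) - r y)
      rw [AddCircle.coe_sub, hr] at this
      refine this.trans_lt ((le_of_eq (congrArg abs e)).trans_lt (lt_of_le_of_lt ?_ hlt))
      rw [abs_neg, abs_div, abs_of_pos hpos]
      exact div_le_div_of_nonneg_right ((abs_sub_round _).trans (by norm_num)) hpos.le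

open Cardinal in
/-- The index set of the characters used in `exists_injective_hom_dense` has at most `2 ^ #K`
elements. -/
theorem mk_circle_family_le {K D : Type u} [Infinite K] (hD : #D ≤ #K) :
    #((Finset D × (D → UnitAddCircle)) ⊕ (Finset (Set K) × Finset (Set K))) ≤ #(Set K) := by
  have hK := aleph0_le_mk K
  have hSK : ℵ₀ ≤ #(Set K) := hK.trans (by rw [mk_set]; exact (cantor _).le)
  have h1 : #(Finset D) ≤ #(Set K) := by
    refine (mk_le_of_injective (f := fun F : Finset D => (F : Set D)) Finset.coe_injective).trans ?_
    rw [mk_set, mk_set]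
    exact power_le_power_left two_ne_zero hD
  have h2 : #(D → UnitAddCircle) ≤ #(Set K) := by
    have hc : #UnitAddCircle ≤ 2 ^ ℵ₀ := by
      have := mk_le_of_surjective
        (QuotientAddGroup.mk_surjective (s := AddSubgroup.zmultiples (1 : ℝ)))
      rwa [mk_real, ← two_power_aleph0] at this
    rw [mk_set]
    calc #(D → UnitAddCircle) = lift.{u} #UnitAddCircle ^ #D := by simp [mk_pi]
      _ ≤ (2 ^ ℵ₀) ^ #D := power_le_power_right (by simpa using lift_le.{u}.2 hc)
      _ = 2 ^ (ℵ₀ * #D) := (power_mul).symm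
      _ ≤ 2 ^ #K := power_le_power_left two_ne_zero
        ((mul_le_mul' hK hD).trans (mul_eq_self hK).le)
  have h3 : #(Finset (Set K)) ≤ #(Set K) := by rw [mk_finset_of_infinite]
  rw [mk_sum, mk_prod, mk_prod]
  simp only [lift_id]
  refine (add_le_add ((mul_le_mul' h1 h2).trans (mul_eq_self hSK).le)
    ((mul_le_mul' h3 h3).trans (mul_eq_self hSK).le)).trans (add_eq_self hSK).le

/-! ### Injective homomorphisms to a power of the circle with dense image -/

open Cardinal in
/-- The characters `χ` detect all points outside the maximal subgroup `H`. Each `ψ` kills `H` and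
compensates on the matching family for `φ`, whose components separate points. If all `χ` and all
`ψ + φ` kill `g`, then `g ∈ H`, hence `ψ` kills `g`, hence so does `φ`, and `g = 0`. -/
theorem exists_injective_hom_dense {K : Type u} [Infinite K] (hG : #G ≤ #(Set (Set K)))
    (S : Set G) (hS : ∀ n : ℕ, 0 < n → #K ≤ #(multiples n S)) :
    ∃ (P : Type u) (f : G →+ (P → UnitAddCircle)), Function.Injective f ∧
      ∀ (z : P → UnitAddCircle) (I : Finset P) (δ : ℝ), 0 < δ →
        ∃ x ∈ S, ∀ p ∈ I, ‖f x p - z p‖ < δ := by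
  classical
  obtain ⟨D, _, N, t, hD, ht⟩ := exists_independent_targets K
  obtain ⟨s, hsS, hs⟩ := exists_matching_family N S fun n hn => hD.trans (hS n hn)
  let ε : D → ℝ := fun d => 2 / (N d + 1)
  have hbot : Matches s ε ⊥ := fun E τ => by
    obtain ⟨χ, hχ⟩ := hs E τ
    exact ⟨χ, fun g hg => by rw [AddSubgroup.mem_bot.1 hg, map_zero], hχ⟩
  obtain ⟨H, hH⟩ := exists_maximal_matches hbot
  obtain ⟨φ, hφ⟩ := exists_separating_characters (Classical.choice hG : G ↪ Set (Set K))
  let P := (Finset D × (D → UnitAddCircle)) ⊕ (Finset (Set K) × Finset (Set K))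
  let ι : P ↪ Set K := Classical.choice (mk_circle_family_le hD)
  choose χ hχH hχ using fun q : Finset D × (D → UnitAddCircle) =>
    hH.1.exists_character fun d => if d ∈ q.1 then q.2 d else t (ι (Sum.inl q)) d
  choose ψ hψH hψ using fun q : Finset (Set K) × Finset (Set K) =>
    hH.1.exists_character fun d => t (ι (Sum.inr q)) d - φ q (s d)
  let f : G →+ (P → UnitAddCircle) := AddMonoidHom.pi (Sum.elim χ fun q => ψ q + φ q)
  refine ⟨P, f, (injective_iff_map_eq_zero f).2 fun g hg => ?_, fun z I δ hδ => ?_⟩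
  · have hgH : g ∈ H := by
      by_contra hnot
      obtain ⟨E, τ, hEτ⟩ := exists_detecting_targets hH hnot
      refine hEτ (χ (E, τ)) (hχH (E, τ)) (fun d hd => ?_) (congrFun hg (Sum.inl (E, τ)))
      simpa [hd] using hχ (E, τ) d
    refine hφ g fun q => ?_
    have h1 : ψ q g + φ q g = 0 := congrFun hg (Sum.inr q)
    rwa [hψH q g hgH, zero_add] at h1
  -- Off `B`, every character involved approximates its independent target at `s d`.
  · let B : Finset D := I.biUnion (Sum.elim (fun q => q.1) fun _ => ∅)
    obtain ⟨d, ⟨hd1, hd2⟩, hdB⟩ := ((ht (I.map ι) (Function.extend ι z 0) (δ / 2)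
      (half_pos hδ)).sdiff B.finite_toSet).nonempty
    refine ⟨s d, hsS d, fun p hp => ?_⟩
    have h1 : ‖f (s d) p - t (ι p) d‖ ≤ ε d := by
      rcases p with q | q
      · have hdq : d ∉ q.1 := fun h => hdB (Finset.mem_biUnion.2 ⟨_, hp, h⟩)
        have := hχ q d
        rwa [if_neg hdq] at this
      · have := hψ q d
        rwa [← sub_add, sub_add_eq_add_sub] at this
    have h2 := hd2 (ι p) (Finset.mem_map_of_mem ι hp)
    rw [ι.injective.extend_apply] at h2
    calc ‖f (s d) p - z p‖ ≤ ‖f (s d) p - t (ι p) d‖ + ‖t (ι p) d - z p‖ :=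
          norm_sub_le_norm_sub_add_norm_sub _ _ _
      _ < δ := by linarith [h1.trans_lt hd1]

/-! ### Topologies and cardinals -/

theorem isPrecompactlyDense_of_injective_hom {P : Type u} (f : G →+ (P → UnitAddCircle))
    (hf : Function.Injective f) (S : Set G)
    (hS : ∀ (z : P → UnitAddCircle) (I : Finset P) (δ : ℝ), 0 < δ →
        ∃ x ∈ S, ∀ p ∈ I, ‖f x p - z p‖ < δ) : IsPrecompactlyDense S := by
  let T : TopologicalSpace G := TopologicalSpace.induced f inferInstance
  have hind : Topology.IsInducing f := ⟨rfl⟩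
  have hemb : Topology.IsEmbedding f := ⟨hind, hf⟩
  refine ⟨T, topologicalAddGroup_induced f, ⟨P → UnitAddCircle, inferInstance, inferInstance,
    inferInstance, inferInstance, inferInstance, f, hemb⟩, ?_⟩
  refine hind.dense_iff.2 fun g => mem_closure_iff_nhds.2 fun V hV => ?_
  rw [nhds_pi, Filter.mem_pi] at hV
  obtain ⟨I, hI, W, hW, hWV⟩ := hV
  have hδ : ∀ p, ∃ δ > 0, Metric.ball (f g p) δ ⊆ W p := fun p => Metric.mem_nhds_iff.1 (hW p)
  choose δ hδ hball using hδ
  obtain ⟨η, hη, hηδ⟩ : ∃ η > 0, ∀ p ∈ hI.toFinset, η ≤ δ p := by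
    rcases hI.toFinset.eq_empty_or_nonempty with h | h
    · exact ⟨1, one_pos, by simp [h]⟩
    · exact ⟨hI.toFinset.inf' h δ, (Finset.lt_inf'_iff h).2 fun p _ => hδ p,
        fun p hp => Finset.inf'_le δ hp⟩
  obtain ⟨x, hx, hxg⟩ := hS (f g) hI.toFinset η hη
  refine ⟨f x, hWV fun p hp => hball p ?_, x, hx, rfl⟩
  have hp' := hI.mem_toFinset.2 hp
  rw [Metric.mem_ball, dist_eq_norm]
  exact (hxg p hp').trans_le (hηδ p hp')

theorem IsPrecompactlyDense.isPotentiallyDense {S : Set G} (h : IsPrecompactlyDense S) :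
    IsPotentiallyDense S := by
  obtain ⟨T, hT, ⟨K, _, _, _, _, _, f, hf⟩, hd⟩ := h
  exact ⟨T, hT, hf.t2Space, hd⟩

open Cardinal Topology in
/-- A point of the closure of `Y` is determined by the traces of its neighbourhoods on `Y`. -/
theorem mk_closure_le_of_t2 {X : Type u} [TopologicalSpace X] [T2Space X] (Y : Set X) :
    #(closure Y) ≤ 2 ^ (2 ^ #Y : Cardinal.{u}) := by
  rw [← mk_set, ← mk_set]
  let tr : closure Y → Set (Set Y) := fun x => {A | ∃ U ∈ 𝓝 (x : X), Subtype.val ⁻¹' U = A}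
  refine mk_le_of_injective (f := tr) fun x y hxy => ?_
  by_contra hne
  obtain ⟨U, V, hU, hV, hUV⟩ := t2_separation_nhds fun h => hne (Subtype.ext h)
  obtain ⟨W, hW, hWU⟩ : (Subtype.val ⁻¹' U : Set Y) ∈ tr y := hxy ▸ ⟨U, hU, rfl⟩
  obtain ⟨z, ⟨hzW, hzV⟩, hzY⟩ := mem_closure_iff_nhds.1 y.2 _ (Filter.inter_mem hW hV)
  have hzU : (⟨z, hzY⟩ : Y) ∈ (Subtype.val ⁻¹' U : Set Y) := hWU ▸ hzW
  exact Set.disjoint_left.1 hUV hzU hzV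

open Cardinal in
theorem mk_multiples_univ_le {S : Set G} (h : IsPotentiallyDense S) (n : ℕ) :
    #(multiples n (Set.univ : Set G)) ≤ 2 ^ (2 ^ #(multiples n S) : Cardinal.{u}) ∧
      ((multiples n S).Finite → (multiples n (Set.univ : Set G)).Finite) := by
  obtain ⟨T, hT, hT2, hd⟩ := h
  have hsub : multiples n (Set.univ : Set G) ⊆ closure (multiples n S) := by
    have := image_closure_subset_closure_image (s := S) (continuous_nsmul (M := G) n)
    rwa [hd.closure_eq] at this
  exact ⟨(mk_le_mk_of_subset hsub).trans (mk_closure_le_of_t2 _), fun hfin =>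
    hfin.subset (hfin.isClosed.closure_eq ▸ hsub)⟩

open Cardinal in
theorem cardLog_le_iff {κ τ : Cardinal.{u}} (hτ : ℵ₀ ≤ τ) : cardLog κ ≤ τ ↔ κ ≤ 2 ^ τ := by
  refine ⟨fun h => ?_, fun h => csInf_le' ⟨hτ, h⟩⟩
  have hmem : cardLog κ ∈ {τ : Cardinal.{u} | ℵ₀ ≤ τ ∧ κ ≤ 2 ^ τ} :=
    csInf_mem ⟨max ℵ₀ κ, le_max_left _ _,
      (le_max_right _ _).trans (cantor _).le⟩
  exact hmem.2.trans (power_le_power_left two_ne_zero h)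

open Cardinal in
theorem aleph0_le_cardLog (κ : Cardinal.{u}) : ℵ₀ ≤ cardLog κ :=
  le_csInf ⟨max ℵ₀ κ, le_max_left _ _, (le_max_right _ _).trans (cantor _).le⟩ fun _ h => h.1

open Cardinal in
theorem cardLog_cardLog_le_iff {κ τ : Cardinal.{u}} (hτ : ℵ₀ ≤ τ) :
    cardLog (cardLog κ) ≤ τ ↔ κ ≤ 2 ^ (2 ^ τ : Cardinal.{u}) := by
  rw [cardLog_le_iff hτ, cardLog_le_iff (hτ.trans (cantor τ).le)]

open Cardinal in
theorem isPrecompactlyDense_of_cardLog_le (S : Set G)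
    (hS : ∀ n : ℕ, 0 < n → cardLog (cardLog #G) ≤ #(multiples n S)) : IsPrecompactlyDense S := by
  obtain ⟨K, hK⟩ : ∃ K : Type u, #K = cardLog (cardLog #G) := ⟨_, mk_out _⟩
  have hinf : ℵ₀ ≤ #K := hK ▸ aleph0_le_cardLog _
  have : Infinite K := infinite_iff.2 hinf
  obtain ⟨P, f, hf, hd⟩ := exists_injective_hom_dense (K := K)
    (by rw [mk_set, mk_set]; exact (cardLog_cardLog_le_iff hinf).1 hK.ge) S
    (fun n hn => hK ▸ hS n hn)
  exact isPrecompactlyDense_of_injective_hom f hf S hd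

end PotentialDensity

theorem mainTheorem7 {G : Type u} [AddCommGroup G]
    (hG : ∀ n : ℕ, 0 < n →
      Cardinal.mk (PotentialDensity.multiples n (Set.univ : Set G)) = Cardinal.mk G)
    (S : Set G) (hS : ¬ S.Countable) :
    List.TFAE [
      PotentialDensity.IsPotentiallyDense S,
      PotentialDensity.IsPrecompactlyDense S,
      ∀ n : ℕ, 0 < n →
        PotentialDensity.cardLog (PotentialDensity.cardLog
          (Cardinal.mk (PotentialDensity.multiples n (Set.univ : Set G)))) ≤
            Cardinal.mk (PotentialDensity.multiples n S),
      PotentialDensity.cardLog (PotentialDensity.cardLog (Cardinal.mk G)) ≤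
        sInf {c : Cardinal.{u} | ∃ n : ℕ, 0 < n ∧
          c = Cardinal.mk (PotentialDensity.multiples n S)}] := by
  tfae_have 1 → 3 := by
    intro h n hn
    obtain ⟨hle, hfin⟩ := PotentialDensity.mk_multiples_univ_le h n
    refine (PotentialDensity.cardLog_cardLog_le_iff ?_).2 hle
    -- A finite set is closed, so a finite `n • S` would be all of `n • G`, which is infinite.
    by_contra hlt
    have h1 := Cardinal.lt_aleph0_iff_set_finite.2
      (hfin (Cardinal.lt_aleph0_iff_set_finite.1 (not_le.1 hlt)))
    rw [hG n hn, Cardinal.lt_aleph0_iff_finite] at h1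
    exact hS S.to_countable
  tfae_have 3 → 4 := by
    intro h
    refine le_csInf ⟨_, 1, one_pos, rfl⟩ ?_
    rintro _ ⟨n, hn, rfl⟩
    rw [← hG n hn]
    exact h n hn
  tfae_have 4 → 2 := fun h => PotentialDensity.isPrecompactlyDense_of_cardLog_le S fun n hn =>
    h.trans (csInf_le' ⟨n, hn, rfl⟩)
  tfae_have 2 → 1 := PotentialDensity.IsPrecompactlyDense.isPotentiallyDense
  tfae_finish
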